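/- Let $n\ge 2$, let $K$ be a field, and let $L_n$ be the line (path) graph with vertices $1,\dots,n$ and edges $\{j,j+1\}$ for $1\le j\le n-1$. Let $S=K[x_1,\dots,x_n]$ and let $I(L_n)=(x_1x_2,x_2x_3,\dots,x_{n-1}x_n)\subset S$ be its edge ideal. Let $\operatorname{depth} L_n$ denote the depth of the $S$-module $S/I(L_n)$, that is, the supremum of the lengths of the $S/I(L_n)$-regular sequences in the graded maximal ideal $(x_1,\dots,x_n)$. Then $\operatorname{depth} L_n$ does not depend on the field $K$ (in particular not on its characteristic), and $$\operatorname{depth} L_n=\begin{cases} \frac{n}{3} & \text{if } n\equiv 0 \pmod 3,\\[1ex] \frac{n+2}{3} & \text{if } n\equiv 1 \pmod 3,\\[1ex] \frac{n+1}{3} & \text{if } n\equiv 2 \pmod 3.\end{cases}$$ -/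

import Mathlib

/-- The edge ideal `I(G)` of a graph `G` on the vertex set `V`, in the polynomial ring over `K`
with one variable for each vertex: it is generated by the monomials `x_i x_j`, for all edges
`{i, j}` of `G`. -/
noncomputable def edgeIdeal (K : Type*) [Field K] {V : Type*} (G : SimpleGraph V) :
    Ideal (MvPolynomial V K) :=
  Ideal.span {f | ∃ i j : V, G.Adj i j ∧ f = MvPolynomial.X i * MvPolynomial.X j}

/-- For an ideal `𝔞` of `R` and an `R`-module `M` with `𝔞 M ≠ M`, the supremum in `ℕ∞` of the
lengths of the `M`-regular sequences whose members all lie in `𝔞`. When `R` is local, or a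
standard graded algebra over a field, and `𝔞` is its (graded) maximal ideal, this is the depth of
the nonzero finitely generated (graded) module `M`. -/
noncomputable def depthAt {R : Type*} [CommRing R] (𝔞 : Ideal R) (M : Type*) [AddCommGroup M]
    [Module R M] : ℕ∞ :=
  sSup {d : ℕ∞ | ∃ rs : List R,
    (∀ r ∈ rs, r ∈ 𝔞) ∧ RingTheory.Sequence.IsRegular M rs ∧ d = (rs.length : ℕ∞)}

/-- The depth of a graph `G` over the field `K`: the depth of the `S`-module `S / I(G)` with respect
to the graded maximal ideal of `S`, generated by the variables, where `S = K[x_v : v ∈ V]`. -/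
noncomputable def graphDepth (K : Type*) [Field K] {V : Type*} (G : SimpleGraph V) : ℕ∞ :=
  depthAt (MvPolynomial.idealOfVars V K) (MvPolynomial V K ⧸ edgeIdeal K G)

/-! The depth is squeezed between two combinatorial numbers, neither of which sees the field. If
some vertices have pairwise disjoint closed neighbourhoods, the sums of the variables over these
form a regular sequence (`card_le_graphDepth`): passing to colons `I : x_c` and sums `I + (x_c)`
reduces to a case where a linear change of coordinates turns the sums into variables. If `A` is a
maximal independent set, `∏ x_a` has annihilator `(x_v : v ∉ A)` in `S/I(G)`, so the depth is at
most `|A|`, the dimension of the quotient by this ideal (`graphDepth_le_card`). On a path, every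
third vertex, suitably started, meets both conditions, and there are `⌈n/3⌉` of them. -/

/-! ### Regular sequences modulo an ideal -/

section RegularModIdeal

open scoped Pointwise

variable {R : Type*} [CommRing R]

/-- The sequence `rs` is weakly regular on `R ⧸ J`, expressed through ideals of `R`. -/
def IdealRegular : Ideal R → List R → Prop
  | _, [] => True
  | J, r :: rs => (∀ a, r * a ∈ J → a ∈ J) ∧ IdealRegular (J ⊔ Ideal.span {r}) rs

theorem IdealRegular.isWeaklyRegular {rs : List R} {J : Ideal R} {M : Type*} [AddCommGroup M]
    [Module R M] (φ : R →ₗ[R] M) (hφ : Function.Surjective φ) (hJ : LinearMap.ker φ = J)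
    (h : IdealRegular J rs) : RingTheory.Sequence.IsWeaklyRegular M rs := by
  induction rs generalizing J M with
  | nil => exact .nil R M
  | cons r rs ih =>
    obtain ⟨h1, h2⟩ := h
    have hmem : ∀ a, φ a = 0 ↔ a ∈ J := fun a => by rw [← hJ, LinearMap.mem_ker]
    refine .cons ?_ (ih ((r • (⊤ : Submodule R M)).mkQ ∘ₗ φ)
      ((Submodule.mkQ_surjective _).comp hφ) ?_ h2)
    · refine isSMulRegular_iff_right_eq_zero_of_smul.2 fun x hx => ?_
      obtain ⟨a, rfl⟩ := hφ x
      rw [← map_smul, hmem] at hx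
      exact (hmem a).2 (h1 a hx)
    · ext a
      simp only [LinearMap.mem_ker, LinearMap.comp_apply, Submodule.mkQ_apply,
        Submodule.Quotient.mk_eq_zero, Submodule.mem_smul_pointwise_iff_exists]
      rw [Submodule.mem_sup]
      constructor
      · rintro ⟨m, -, hm⟩
        obtain ⟨b, rfl⟩ := hφ m
        refine ⟨a - r * b, (hmem _).1 ?_, r * b, Ideal.mem_span_singleton.2 ⟨b, rfl⟩, by ring⟩
        rw [map_sub, ← smul_eq_mul, map_smul, hm, sub_self]
      · rintro ⟨y, hy, z, hz, rfl⟩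
        obtain ⟨b, rfl⟩ := Ideal.mem_span_singleton.1 hz
        exact ⟨φ b, trivial, by rw [map_add, (hmem y).2 hy, zero_add, ← map_smul, smul_eq_mul]⟩

/-- Weak regularity modulo `J` follows from weak regularity modulo `J : c` and `J + (c)`. -/
theorem IdealRegular.of_colon {rs : List R} {J J' : Ideal R} {c : R}
    (hc : ∀ a, c * a ∈ J ↔ a ∈ J') (h' : IdealRegular J' rs)
    (h : IdealRegular (J ⊔ Ideal.span {c}) rs) : IdealRegular J rs := by
  induction rs generalizing J J' with
  | nil => trivial
  | cons r rs ih =>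
    have key : ∀ z, r * z ∈ J ⊔ Ideal.span {c} → ∃ j ∈ J, ∃ s, z = j + c * s := by
      intro z hz
      obtain ⟨j, hj, y, hy, e⟩ := Submodule.mem_sup.1 (h.1 z hz)
      obtain ⟨s, rfl⟩ := Ideal.mem_span_singleton.1 hy
      exact ⟨j, hj, s, e.symm⟩
    -- The induction needs `(J + (r)) : c = J' + (r)`; this holds because `r` is regular modulo `J +
    -- (c)`.
    refine ⟨fun a ha => ?_, ih (J' := J' ⊔ Ideal.span {r}) (fun a => ?_) h'.2 ?_⟩
    · obtain ⟨j, hj, s, rfl⟩ := key a (Ideal.mem_sup_left ha)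
      refine J.add_mem hj ((hc s).2 (h'.1 s ((hc _).1 ?_)))
      have := J.sub_mem ha (J.mul_mem_left r hj)
      convert this using 1
      ring
    · rw [Submodule.mem_sup, Submodule.mem_sup]
      constructor
      · rintro ⟨j, hj, y, hy, e⟩
        obtain ⟨z, rfl⟩ := Ideal.mem_span_singleton.1 hy
        have hz : r * z ∈ J ⊔ Ideal.span {c} := by
          have : r * z = - j + c * a := by rw [← e]; ring
          rw [this]
          exact Ideal.add_mem _ (Ideal.mem_sup_left (J.neg_mem hj))
            (Ideal.mem_sup_right (Ideal.mem_span_singleton.2 ⟨a, rfl⟩))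
        obtain ⟨j', hj', s, rfl⟩ := key z hz
        refine ⟨a - r * s, (hc _).1 ?_, r * s, Ideal.mem_span_singleton.2 ⟨s, rfl⟩, by ring⟩
        have : c * (a - r * s) = j + r * j' := by rw [mul_sub, ← e]; ring
        rw [this]
        exact J.add_mem hj (J.mul_mem_left r hj')
      · rintro ⟨j, hj, y, hy, rfl⟩
        obtain ⟨z, rfl⟩ := Ideal.mem_span_singleton.1 hy
        exact ⟨c * j, (hc j).2 hj, r * (c * z), Ideal.mem_span_singleton.2 ⟨_, rfl⟩, by ring⟩
    · rw [sup_right_comm]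
      exact h.2

theorem IdealRegular.of_map {R' : Type*} [CommRing R'] (e : R ≃+* R') {rs : List R}
    {J : Ideal R} {J' : Ideal R'} (hJ : ∀ a, e a ∈ J' ↔ a ∈ J)
    (h : IdealRegular J' (rs.map e)) : IdealRegular J rs := by
  induction rs generalizing J J' with
  | nil => trivial
  | cons r rs ih =>
    refine ⟨fun a ha => (hJ a).1 (h.1 _ ?_), ih (fun a => ?_) h.2⟩
    · rw [← map_mul]
      exact (hJ _).2 ha
    · simp only [Submodule.mem_sup, Ideal.mem_span_singleton]
      constructor
      · rintro ⟨j, hj, _, ⟨z, rfl⟩, ha⟩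
        refine ⟨e.symm j, (hJ _).1 (by simpa using hj), r * e.symm z, ⟨_, rfl⟩, e.injective ?_⟩
        simpa using ha
      · rintro ⟨j, hj, _, ⟨z, rfl⟩, rfl⟩
        exact ⟨e j, (hJ j).2 hj, e r * e z, ⟨_, rfl⟩, by simp⟩

end RegularModIdeal

/-! ### Chains of associated primes along a regular sequence -/

section AssociatedPrimes

open scoped Pointwise

variable {R : Type*} [CommRing R] [IsNoetherianRing R]

theorem exists_associatedPrime_le {M : Type*} [AddCommGroup M] [Module R M] [Module.Finite R M]
    {𝔪 : Ideal R} [𝔪.IsPrime] (h : Module.annihilator R M ≤ 𝔪) :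
    ∃ q ∈ associatedPrimes R M, Module.annihilator R M ≤ q ∧ q ≤ 𝔪 := by
  obtain ⟨q, hq, hle⟩ := Ideal.exists_minimalPrimes_le h
  exact ⟨q, Module.associatedPrimes.minimalPrimes_annihilator_subset_associatedPrimes R M hq,
    hq.1.2, hle⟩

/-- Dividing out a regular element enlarges an associated prime. -/
theorem exists_associatedPrime_quotSMulTop {M : Type*} [AddCommGroup M] [Module R M]
    [Module.Finite R M] {𝔪 p : Ideal R} [𝔪.IsPrime] (hp : p ∈ associatedPrimes R M)
    (hpm : p ≤ 𝔪) {x : R} (hx : x ∈ 𝔪) (hreg : IsSMulRegular M x) :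
    ∃ q ∈ associatedPrimes R (QuotSMulTop x M), p < q ∧ q ≤ 𝔪 := by
  obtain ⟨hprime, m, hm⟩ := isAssociatedPrime_iff.1 hp
  have hmem : ∀ r, r ∈ p ↔ r • m = 0 := fun r => by
    rw [hm, Submodule.mem_colon_singleton, Submodule.mem_bot]
  -- `N` is the part of `M` killed by `p`. Regularity of `x` makes `N/xN` embed in `M/xM`, and an
  -- associated prime of `N/xN` contains both `p` and `x ∉ p`.
  let N : Submodule R M := ⨅ r : p, LinearMap.ker (LinearMap.lsmul R M r)
  have hN : ∀ y, y ∈ N ↔ ∀ r ∈ p, r • y = 0 := fun y => by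
    simp [N, Submodule.mem_iInf]
  have hmN : m ∈ N := (hN m).2 fun r hr => (hmem r).1 hr
  have hannN : Module.annihilator R N ≤ p := fun r hr => by
    rw [hmem]
    simpa using congrArg Subtype.val (Module.mem_annihilator.1 hr ⟨m, hmN⟩)
  have hsupp : (⟨𝔪, ‹_›⟩ : PrimeSpectrum R) ∈ Module.support R (QuotSMulTop x N) := by
    rw [Module.support_quotSMulTop]
    refine ⟨Module.mem_support_iff_of_finite.2 (hannN.trans hpm), ?_⟩
    simpa [PrimeSpectrum.mem_zeroLocus] using hx
  obtain ⟨q, hq, hannq, hqm⟩ :=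
    exists_associatedPrime_le (Module.annihilator_le_of_mem_support hsupp)
  have hinj : Function.Injective (QuotSMulTop.map x N.subtype) := by
    rw [← LinearMap.ker_eq_bot, LinearMap.ker_eq_bot']
    intro y hy
    obtain ⟨y, rfl⟩ := Submodule.Quotient.mk_surjective _ y
    rw [QuotSMulTop.map_apply_mk, Submodule.Quotient.mk_eq_zero,
      Submodule.mem_smul_pointwise_iff_exists] at hy
    obtain ⟨z, -, hz⟩ := hy
    have hzN : z ∈ N := (hN z).2 fun r hr => by
      refine hreg.right_eq_zero_of_smul ?_
      rw [smul_comm, hz]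
      exact (hN _).1 y.2 r hr
    rw [Submodule.Quotient.mk_eq_zero, Submodule.mem_smul_pointwise_iff_exists]
    exact ⟨⟨z, hzN⟩, trivial, Subtype.ext hz⟩
  refine ⟨q, associatedPrimes.subset_of_injective hinj hq, ?_, hqm⟩
  have hxp : x ∉ p := fun h => hprime.ne_top <| (Ideal.eq_top_iff_one _).2 <| by
    rw [hmem, one_smul]
    exact hreg.right_eq_zero_of_smul ((hmem x).1 h)
  refine lt_of_le_of_ne (fun r hr => hannq ?_) fun h => hxp (h ▸ hannq ?_)
  · refine Module.mem_annihilator.2 fun y => ?_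
    obtain ⟨y, rfl⟩ := Submodule.Quotient.mk_surjective _ y
    rw [← Submodule.Quotient.mk_smul, Submodule.Quotient.mk_eq_zero]
    convert Submodule.zero_mem _
    exact Subtype.ext ((hN _).1 y.2 r hr)
  · refine Module.mem_annihilator.2 fun y => ?_
    obtain ⟨y, rfl⟩ := Submodule.Quotient.mk_surjective _ y
    rw [← Submodule.Quotient.mk_smul, Submodule.Quotient.mk_eq_zero]
    exact Submodule.smul_mem_pointwise_smul _ _ _ trivial

/-- Each member of the sequence strictly enlarges an associated prime inside `𝔪`. Heights are taken
in `R ⧸ I` so that Krull's theorem can bound the right side by the number of generators of `𝔪/I`. -/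
theorem height_map_add_length_le {I 𝔪 p : Ideal R} [𝔪.IsPrime] {M : Type*} [AddCommGroup M]
    [Module R M] [Module.Finite R M] (hp : p ∈ associatedPrimes R M) (hI : I ≤ p) (hpm : p ≤ 𝔪)
    {rs : List R} (hrs : ∀ r ∈ rs, r ∈ 𝔪) (hreg : RingTheory.Sequence.IsWeaklyRegular M rs) :
    (p.map (Ideal.Quotient.mk I)).height + rs.length ≤
      (𝔪.map (Ideal.Quotient.mk I)).height := by
  induction rs generalizing M p with
  | nil => simpa using Ideal.height_mono (Ideal.map_mono hpm)
  | cons r rs ih =>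
    rw [RingTheory.Sequence.isWeaklyRegular_cons_iff] at hreg
    obtain ⟨q, hq, hpq, hqm⟩ :=
      exists_associatedPrime_quotSMulTop hp hpm (hrs r List.mem_cons_self) hreg.1
    refine le_trans ?_ (ih hq (hI.trans hpq.le) hqm
      (fun s hs => hrs s (List.mem_cons_of_mem _ hs)) hreg.2)
    have hker : ∀ J : Ideal R, I ≤ J →
        (J.map (Ideal.Quotient.mk I)).comap (Ideal.Quotient.mk I) = J := fun J hJ => by
      rw [Ideal.comap_map_of_surjective' _ Ideal.Quotient.mk_surjective, Ideal.mk_ker]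
      exact sup_eq_left.2 hJ
    have : p.IsPrime := IsAssociatedPrime.isPrime hp
    have : q.IsPrime := IsAssociatedPrime.isPrime hq
    have : (p.map (Ideal.Quotient.mk I)).IsPrime :=
      Ideal.map_isPrime_of_surjective Ideal.Quotient.mk_surjective (by rwa [Ideal.mk_ker])
    have : (q.map (Ideal.Quotient.mk I)).IsPrime :=
      Ideal.map_isPrime_of_surjective Ideal.Quotient.mk_surjective
        (by rw [Ideal.mk_ker]; exact hI.trans hpq.le)
    have hlt : p.map (Ideal.Quotient.mk I) < q.map (Ideal.Quotient.mk I) := by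
      refine lt_of_le_of_ne (Ideal.map_mono hpq.le) fun h => hpq.ne ?_
      rw [← hker p hI, h, hker q (hI.trans hpq.le)]
    have h1 : (p.map (Ideal.Quotient.mk I)).height + 1 ≤ (q.map (Ideal.Quotient.mk I)).height :=
      Ideal.height_add_one_le_of_lt_of_isPrime hlt
    rw [List.length_cons, Nat.cast_add, Nat.cast_one, add_comm (rs.length : ℕ∞), ← add_assoc]
    gcongr

end AssociatedPrimes

/-! ### Edge ideals with some variables killed, and the lower bound's regular sequence -/

section PartialEdgeIdeal

open MvPolynomial

variable {K V : Type*} [Field K]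

/-- The sum of the edge ideal of `G` and the ideal generated by the variables in `D`. -/
noncomputable def partialEdgeIdeal (K : Type*) [Field K] {V : Type*} (G : SimpleGraph V)
    (D : Set V) : Ideal (MvPolynomial V K) :=
  edgeIdeal K G ⊔ Ideal.span (X '' D)

variable {G : SimpleGraph V} {D : Set V}

/-- The ideal is monomial with squarefree generators (`G` has no loops), so only the supports of the
exponents matter. -/
theorem mem_partialEdgeIdeal_iff {f : MvPolynomial V K} :
    f ∈ partialEdgeIdeal K G D ↔ ∀ m ∈ f.support,
      (∃ d ∈ D, m d ≠ 0) ∨ ∃ i j, G.Adj i j ∧ m i ≠ 0 ∧ m j ≠ 0 := by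
  classical
  have hspan : partialEdgeIdeal K G D = Ideal.span ((fun s => monomial s (1 : K)) ''
      ({s | ∃ i j, G.Adj i j ∧ s = Finsupp.single i 1 + Finsupp.single j 1} ∪
        (fun d => Finsupp.single d 1) '' D)) := by
    rw [partialEdgeIdeal, edgeIdeal, ← Ideal.span_union, Set.image_union, Set.image_image]
    congr 2
    ext f
    constructor
    · rintro ⟨i, j, h, rfl⟩
      exact ⟨_, ⟨i, j, h, rfl⟩, by simp [X, monomial_mul]⟩
    · rintro ⟨_, ⟨i, j, h, rfl⟩, rfl⟩
      exact ⟨i, j, h, by simp [X, monomial_mul]⟩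
  rw [hspan, mem_ideal_span_monomial_image]
  refine forall₂_congr fun m _ => ?_
  constructor
  · rintro ⟨s, ⟨i, j, h, rfl⟩ | ⟨d, hd, rfl⟩, hs⟩
    · refine .inr ⟨i, j, h, ?_, ?_⟩
      · have := hs i
        simp at this
        omega
      · have := hs j
        simp at this
        omega
    · exact .inl ⟨d, hd, by have := hs d; simp at this; omega⟩
  · rintro (⟨d, hd, h⟩ | ⟨i, j, h, hi, hj⟩)
    · refine ⟨_, .inr ⟨d, hd, rfl⟩, ?_⟩
      simpa [Nat.one_le_iff_ne_zero] using h
    · refine ⟨_, .inl ⟨i, j, h, rfl⟩, fun x => ?_⟩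
      have := h.ne
      simp only [Finsupp.add_apply, Finsupp.single_apply]
      split_ifs with h1 h2 h2 <;> subst_vars <;> first | contradiction | omega

theorem partialEdgeIdeal_empty : partialEdgeIdeal K G ∅ = edgeIdeal K G := by
  simp [partialEdgeIdeal]

theorem partialEdgeIdeal_sup_span_X (c : V) :
    partialEdgeIdeal K G D ⊔ Ideal.span {X c} = partialEdgeIdeal K G (insert c D) := by
  rw [partialEdgeIdeal, partialEdgeIdeal, sup_assoc, ← Ideal.span_union, Set.image_insert_eq,
    Set.union_singleton]

theorem X_mem_partialEdgeIdeal {d : V} (hd : d ∈ D) : X d ∈ partialEdgeIdeal K G D :=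
  Ideal.mem_sup_right (Ideal.subset_span ⟨d, hd, rfl⟩)

theorem X_mul_X_mem_edgeIdeal {i j : V} (h : G.Adj i j) : X i * X j ∈ edgeIdeal K G :=
  Ideal.subset_span ⟨i, j, h, rfl⟩

/-- Dividing by `X c` turns each edge at `c` into the variable at its other end, so colons stay in
the family. -/
theorem X_mul_mem_partialEdgeIdeal_iff {c : V} (hc : c ∉ D) (f : MvPolynomial V K) :
    X c * f ∈ partialEdgeIdeal K G D ↔ f ∈ partialEdgeIdeal K G (D ∪ G.neighborSet c) := by
  classical
  constructor
  · intro h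
    rw [mem_partialEdgeIdeal_iff] at h ⊢
    intro m hm
    have hm' : Finsupp.single c 1 + m ∈ (X c * f).support := by
      rw [mem_support_iff, coeff_X_mul]
      exact mem_support_iff.1 hm
    have hne : ∀ {i : V}, i ≠ c → (Finsupp.single c 1 + m : V →₀ ℕ) i ≠ 0 → m i ≠ 0 := by
      intro i hi h
      simpa [Finsupp.single_apply, hi.symm] using h
    rcases h _ hm' with ⟨d, hd, h⟩ | ⟨i, j, hij, hi, hj⟩
    · exact .inl ⟨d, .inl hd, hne (fun e => hc (e ▸ hd)) h⟩
    · by_cases hic : i = c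
      · subst hic
        exact .inl ⟨j, .inr hij, hne hij.ne' hj⟩
      by_cases hjc : j = c
      · subst hjc
        exact .inl ⟨i, .inr hij.symm, hne hic hi⟩
      · exact .inr ⟨i, j, hij, hne hic hi, hne hjc hj⟩
  · intro h
    rw [partialEdgeIdeal] at h
    obtain ⟨a, ha, b, hb, rfl⟩ := Submodule.mem_sup.1 h
    rw [mul_add]
    refine Ideal.add_mem _ (Ideal.mul_mem_left _ _ (Ideal.mem_sup_left ha)) ?_
    have hle : Ideal.span (X '' (D ∪ G.neighborSet c)) ≤
        Submodule.comap (LinearMap.mulLeft (MvPolynomial V K) (X c)) (partialEdgeIdeal K G D) := by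
      rw [Ideal.span, Submodule.span_le]
      rintro _ ⟨d, hd | hd, rfl⟩
      · exact Ideal.mul_mem_left _ _ (X_mem_partialEdgeIdeal hd)
      · exact Ideal.mem_sup_left (X_mul_X_mem_edgeIdeal hd)
    exact hle hb

theorem idealRegular_map_X {T : List V} (hnd : T.Nodup) (hD : ∀ t ∈ T, t ∉ D)
    (hN : ∀ t ∈ T, G.neighborSet t ⊆ D) :
    IdealRegular (partialEdgeIdeal K G D) (T.map X) := by
  induction T generalizing D with
  | nil => trivial
  | cons t T ih =>
    rw [List.nodup_cons] at hnd
    simp only [List.mem_cons, forall_eq_or_imp] at hD hN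
    refine ⟨fun a ha => ?_, ?_⟩
    · rwa [X_mul_mem_partialEdgeIdeal_iff hD.1, Set.union_eq_self_of_subset_right hN.1] at ha
    · rw [partialEdgeIdeal_sup_span_X]
      refine ih hnd.2 (fun s hs h => ?_) fun s hs => (hN.2 s hs).trans (Set.subset_insert _ _)
      rcases h with rfl | h
      · exact hnd.1 hs
      · exact hD.2 s hs h

/-- The change of variables `x ↦ x + g x`. -/
noncomputable def shearHom (g : V → MvPolynomial V K) : MvPolynomial V K →ₐ[K] MvPolynomial V K :=
  aeval fun x => X x + g x

/-- The change of variables `x ↦ x + g x` as an automorphism, when each `g x` involves only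
variables which are fixed. -/
noncomputable def shearEquiv (g : V → MvPolynomial V K)
    (hg : ∀ x, shearHom g (g x) = g x) (hg' : ∀ x, shearHom (-g) (g x) = g x) :
    MvPolynomial V K ≃ₐ[K] MvPolynomial V K :=
  AlgEquiv.ofAlgHom (shearHom g) (shearHom (-g))
    (by ext x : 1; simp [shearHom] at hg ⊢; simp [hg])
    (by ext x : 1; simp [shearHom] at hg' ⊢; simp [hg'])

theorem shearHom_eq_self {g : V → MvPolynomial V K} {W : Finset V} (h : ∀ w ∈ W, g w = 0) :
    shearHom g (∑ w ∈ W, X w) = ∑ w ∈ W, X w := by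
  rw [map_sum]
  exact Finset.sum_congr rfl fun w hw => by simp [shearHom, h w hw]

/-- Every edge at a moved vertex ends in `D`, so its generator is sent to a multiple of a fixed
variable of `D`. -/
theorem shearHom_mem_partialEdgeIdeal {g : V → MvPolynomial V K} (hD : ∀ x ∈ D, g x = 0)
    (hN : ∀ x, g x ≠ 0 → G.neighborSet x ⊆ D) {f : MvPolynomial V K}
    (hf : f ∈ partialEdgeIdeal K G D) : shearHom g f ∈ partialEdgeIdeal K G D := by
  have hX : ∀ x ∈ D, shearHom g (X x) = X x := fun x hx => by simp [shearHom, hD x hx]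
  have hle : partialEdgeIdeal K G D ≤ (partialEdgeIdeal K G D).comap (shearHom g) := by
    refine sup_le (Ideal.span_le.2 ?_) (Ideal.span_le.2 ?_)
    · rintro _ ⟨i, j, h, rfl⟩
      rw [SetLike.mem_coe, Ideal.mem_comap]
      rw [map_mul]
      by_cases hi : g i = 0
      · by_cases hj : g j = 0
        · rw [show shearHom g (X i) = X i by simp [shearHom, hi],
            show shearHom g (X j) = X j by simp [shearHom, hj]]
          exact Ideal.mem_sup_left (X_mul_X_mem_edgeIdeal h)
        · have hi' : i ∈ D := hN j hj h.symm
          rw [hX i hi']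
          exact Ideal.mul_mem_right _ _ (X_mem_partialEdgeIdeal hi')
      · have hj' : j ∈ D := hN i hi h
        rw [hX j hj']
        exact Ideal.mul_mem_left _ _ (X_mem_partialEdgeIdeal hj')
    · rintro _ ⟨d, hd, rfl⟩
      rw [SetLike.mem_coe, Ideal.mem_comap]
      rw [hX d hd]
      exact X_mem_partialEdgeIdeal hd
  exact hle hf

/-- Sums of variables over disjoint sets, each containing a variable that occurs in no edge
outside `D`, are weakly regular. -/
theorem idealRegular_map_sum_of_free {L : List V} (hnd : L.Nodup) (B : V → Finset V)
    (hB : ∀ b ∈ L, ∀ c ∈ L, b ≠ c → Disjoint (B b) (B c))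
    (hfree : ∀ b ∈ L, ∃ v ∈ B b, v ∉ D ∧ G.neighborSet v ⊆ D) :
    IdealRegular (partialEdgeIdeal K G D) (L.map fun b => ∑ w ∈ B b, X w) := by
  classical
  choose! v hvB hvD hvN using hfree
  have hinj : ∀ b ∈ L, ∀ c ∈ L, v b ∈ B c → b = c := fun b hb c hc h => by
    by_contra hne
    exact Finset.disjoint_left.1 (hB b hb c hc hne) (hvB b hb) h
  -- The shear sends `X (v b)` to itself minus the rest of its block, hence the block sum to `X (v
  -- b)`. Disjointness makes `b` unique.
  let g : V → MvPolynomial V K := fun x =>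
    if h : ∃ b ∈ L, v b = x then - ∑ w ∈ (B h.choose).erase x, X w else 0
  have hgv : ∀ b ∈ L, g (v b) = - ∑ w ∈ (B b).erase (v b), X w := fun b hb => by
    have h : ∃ c ∈ L, v c = v b := ⟨b, hb, rfl⟩
    have hc : h.choose = b :=
      hinj _ h.choose_spec.1 _ hb (by rw [h.choose_spec.2]; exact hvB b hb)
    simp only [g, dif_pos h, hc]
  have hg0 : ∀ x, (∀ b ∈ L, v b ≠ x) → g x = 0 := fun x hx =>
    dif_neg fun ⟨b, hb, h⟩ => hx b hb h
  have hgW : ∀ b ∈ L, ∀ w ∈ (B b).erase (v b), g w = 0 := fun b hb w hw =>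
    hg0 w fun c hc h => by
      subst h
      rw [Finset.mem_erase] at hw
      exact hw.1 (by rw [hinj c hc b hb hw.2])
  have hfix : ∀ g' : V → MvPolynomial V K, (∀ x, g x = 0 → g' x = 0) →
      ∀ x, shearHom g' (g x) = g x := fun g' hg' x => by
    by_cases hx : ∃ b ∈ L, v b = x
    · obtain ⟨b, hb, rfl⟩ := hx
      rw [hgv b hb, map_neg, shearHom_eq_self fun w hw => hg' w (hgW b hb w hw)]
    · rw [hg0 x fun b hb h => hx ⟨b, hb, h⟩, map_zero]
  have hneg : ∀ x, g x = 0 → (-g) x = 0 := fun x hx => by simp [hx]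
  let e := shearEquiv g (hfix g fun _ h => h) (hfix (-g) hneg)
  have hgD : ∀ x ∈ D, g x = 0 := fun x hx => hg0 x fun b hb h => hvD b hb (h ▸ hx)
  have hgN : ∀ x, g x ≠ 0 → G.neighborSet x ⊆ D := fun x hx => by
    by_contra hN
    exact hx (hg0 x fun b hb h => hN (h ▸ hvN b hb))
  refine IdealRegular.of_map e.toRingEquiv (J' := partialEdgeIdeal K G D) (fun a => ⟨fun h => ?_,
    fun h => shearHom_mem_partialEdgeIdeal hgD hgN h⟩) ?_
  · have := shearHom_mem_partialEdgeIdeal (g := -g) (fun x hx => hneg x (hgD x hx))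
      (fun x hx => hgN x fun h => hx (hneg x h)) h
    rwa [show shearHom (-g) (e.toRingEquiv a) = a from e.symm_apply_apply a] at this
  · have hmap : (L.map fun b => ∑ w ∈ B b, X w).map e.toRingEquiv =
        (L.map v).map (X : V → MvPolynomial V K) := by
      rw [List.map_map, List.map_map]
      refine List.map_congr_left fun b hb => ?_
      change shearHom g (∑ w ∈ B b, X w) = X (v b)
      rw [← Finset.add_sum_erase _ _ (hvB b hb), map_add, shearHom_eq_self (hgW b hb)]
      simp [shearHom, hgv b hb]
    rw [hmap]
    refine idealRegular_map_X (hnd.map_on fun b hb c hc h => hinj b hb c hc (h ▸ hvB c hc)) ?_ ?_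
    · simpa using hvD
    · simpa using hvN

variable [Fintype V]

/-- The closed neighbourhood of a vertex, as a finite set. -/
noncomputable def closedNeighborFinset (G : SimpleGraph V) (b : V) : Finset V := by
  classical exact Finset.univ.filter fun w => w = b ∨ G.Adj b w

theorem mem_closedNeighborFinset {b w : V} :
    w ∈ closedNeighborFinset G b ↔ w = b ∨ G.Adj b w := by
  simp [closedNeighborFinset]

/-- Call `v ∉ D` free if its neighbours lie in `D`. If the block of `b` has no free vertex, then `b
∉ D` has a neighbour `c ∉ D`. The colon by `X c` makes `c` free, while adding `X c` keeps `b`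
outside `D`; both enlarge `D`. Other blocks keep the invariant `hD` because they miss `c`. -/
theorem idealRegular_partialEdgeIdeal {L : List V} (hnd : L.Nodup)
    (hL : ∀ b ∈ L, ∀ c ∈ L, b ≠ c →
      Disjoint (closedNeighborFinset G b) (closedNeighborFinset G c)) (D : Set V)
    (hD : ∀ b ∈ L, b ∉ D ∨ ∃ v ∈ closedNeighborFinset G b, v ∉ D ∧ G.neighborSet v ⊆ D) :
    IdealRegular (partialEdgeIdeal K G D)
      (L.map fun b => ∑ w ∈ closedNeighborFinset G b, X w) := by
  induction hk : Dᶜ.ncard using Nat.strong_induction_on generalizing D with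
  | _ k ih =>
  by_cases hfree : ∀ b ∈ L, ∃ v ∈ closedNeighborFinset G b, v ∉ D ∧ G.neighborSet v ⊆ D
  · exact idealRegular_map_sum_of_free hnd _ hL hfree
  push Not at hfree
  obtain ⟨b, hb, hbfree⟩ := hfree
  have hbD : b ∉ D := (hD b hb).resolve_right fun ⟨v, h1, h2, h3⟩ => hbfree v h1 h2 h3
  obtain ⟨c, hbc, hcD⟩ :=
    Set.not_subset.1 (hbfree b (mem_closedNeighborFinset.2 (.inl rfl)) hbD)
  have hcB : c ∈ closedNeighborFinset G b := mem_closedNeighborFinset.2 (.inr hbc)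
  have hother : ∀ a ∈ L, a ≠ b → c ∉ closedNeighborFinset G a := fun a ha hab h =>
    Finset.disjoint_left.1 (hL a ha b hb hab) h hcB
  have hlt : ∀ (E : Set V) (x : V), D ⊆ E → x ∈ E → x ∉ D → Eᶜ.ncard < k := fun E x h hx hx' => by
    rw [← hk]
    refine Set.ncard_lt_ncard ⟨Set.compl_subset_compl.2 h, fun h' => ?_⟩ (Set.toFinite _)
    exact h' hx' hx
  refine IdealRegular.of_colon (fun a => X_mul_mem_partialEdgeIdeal_iff hcD a)
    (ih _ (hlt (D ∪ G.neighborSet c) b Set.subset_union_left (.inr (G.adj_symm hbc)) hbD) _ ?_ rfl)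
    ?_
  · intro a ha
    by_cases hab : a = b
    · subst hab
      refine .inr ⟨c, hcB, ?_, Set.subset_union_right⟩
      rintro (h | h)
      · exact hcD h
      · exact G.loopless.irrefl c h
    rcases hD a ha with haD | ⟨v, hv, hvD, hvN⟩
    · refine .inl ?_
      rintro (h | h)
      · exact haD h
      · exact hother a ha hab (mem_closedNeighborFinset.2 (.inr (G.adj_symm h)))
    · refine .inr ⟨v, hv, ?_, hvN.trans Set.subset_union_left⟩
      rintro (h | h)
      · exact hvD h
      · exact hcD (hvN (G.adj_symm h))
  · rw [partialEdgeIdeal_sup_span_X]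
    refine ih _ (hlt (insert c D) c (Set.subset_insert _ _) (Set.mem_insert _ _) hcD) _ ?_ rfl
    intro a ha
    by_cases hab : a = b
    · subst hab
      refine .inl ?_
      rintro (h | h)
      · exact hbc.ne h
      · exact hbD h
    rcases hD a ha with haD | ⟨v, hv, hvD, hvN⟩
    · refine .inl ?_
      rintro (rfl | h)
      · exact hother a ha hab (mem_closedNeighborFinset.2 (.inl rfl))
      · exact haD h
    · refine .inr ⟨v, hv, ?_, hvN.trans (Set.subset_insert _ _)⟩
      rintro (rfl | h)
      · exact hother a ha hab hv
      · exact hvD h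

end PartialEdgeIdeal

/-! ### The two bounds on the depth of a graph -/

section GraphDepth

open MvPolynomial

variable {K V : Type*} [Field K]

theorem idealOfVars_isPrime : (idealOfVars V K).IsPrime := by
  have : idealOfVars V K = RingHom.ker (constantCoeff (σ := V) (R := K)) := by
    ext f
    rw [idealOfVars, ← Set.image_univ, mem_ideal_span_X_image, RingHom.mem_ker,
      constantCoeff_eq, ← notMem_support_iff]
    constructor
    · intro h h0
      obtain ⟨i, -, hi⟩ := h 0 h0
      exact hi rfl
    · intro h m hm
      by_contra! hne
      exact h (by rwa [show m = 0 from Finsupp.ext fun i => hne i trivial] at hm)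
  rw [this]
  exact RingHom.ker_isPrime _

theorem edgeIdeal_le_idealOfVars (G : SimpleGraph V) : edgeIdeal K G ≤ idealOfVars V K := by
  refine Ideal.span_le.2 ?_
  rintro _ ⟨i, j, -, rfl⟩
  exact Ideal.mul_mem_left _ _ (Ideal.subset_span ⟨j, rfl⟩)

variable [Fintype V] {G : SimpleGraph V} {A : Finset V}

/-- Disjoint closed neighbourhoods bound the depth of a graph from below. -/
theorem card_le_graphDepth
    (hA : ∀ b ∈ A, ∀ c ∈ A, b ≠ c →
      Disjoint (closedNeighborFinset G b) (closedNeighborFinset G c)) :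
    (A.card : ℕ∞) ≤ graphDepth K G := by
  have hreg : IdealRegular (edgeIdeal K G)
      (A.toList.map fun b => ∑ w ∈ closedNeighborFinset G b, X w) := by
    rw [← partialEdgeIdeal_empty]
    exact idealRegular_partialEdgeIdeal A.nodup_toList (by simpa using hA) ∅ (by simp)
  have hmem : ∀ r ∈ A.toList.map fun b => ∑ w ∈ closedNeighborFinset G b,
      (X w : MvPolynomial V K), r ∈ idealOfVars V K := by
    intro r hr
    obtain ⟨b, -, rfl⟩ := List.mem_map.1 hr
    exact Ideal.sum_mem _ fun w _ => Ideal.subset_span ⟨w, rfl⟩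
  refine le_sSup ⟨_, hmem, ⟨hreg.isWeaklyRegular (edgeIdeal K G).mkQ
    (Submodule.mkQ_surjective _) (Submodule.ker_mkQ _), fun htop => ?_⟩, by simp⟩
  -- Regularity also needs a nonzero final quotient: the sequence stays inside the proper ideal of
  -- the variables.
  have hle : Ideal.ofList (A.toList.map fun b => ∑ w ∈ closedNeighborFinset G b,
      (X w : MvPolynomial V K)) •
      (⊤ : Submodule (MvPolynomial V K) (MvPolynomial V K ⧸ edgeIdeal K G)) ≤
        Submodule.map (edgeIdeal K G).mkQ (idealOfVars V K) := by
    refine Submodule.smul_le.2 fun r hr y _ => ?_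
    obtain ⟨a, rfl⟩ := Submodule.mkQ_surjective _ y
    exact ⟨r * a, Ideal.mul_mem_right _ _ (Ideal.span_le.2 hmem hr), rfl⟩
  rw [← htop] at hle
  obtain ⟨a, ha, h⟩ := hle (x := (edgeIdeal K G).mkQ 1) trivial
  rw [← sub_eq_zero, ← map_sub, Submodule.mkQ_apply, Submodule.Quotient.mk_eq_zero] at h
  refine (idealOfVars_isPrime (K := K) (V := V)).ne_top ((Ideal.eq_top_iff_one _).2 ?_)
  have := Ideal.sub_mem _ ha (edgeIdeal_le_idealOfVars G h)
  simpa using this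

/-- A maximal independent set bounds the depth of a graph from above. -/
theorem graphDepth_le_card (hind : ∀ a ∈ A, ∀ b ∈ A, ¬ G.Adj a b)
    (hdom : ∀ v ∉ A, ∃ a ∈ A, G.Adj v a) : graphDepth K G ≤ A.card := by
  classical
  refine sSup_le ?_
  rintro _ ⟨rs, hrs, hreg, rfl⟩
  have h𝔪 := idealOfVars_isPrime (K := K) (V := V)
  let I : Ideal (MvPolynomial V K) := Ideal.span (X '' {v | v ∉ A})
  have hIm : I ≤ idealOfVars V K := Ideal.span_mono (Set.image_subset_range _ _)
  -- The annihilator of the class of `y` is `I`: one inclusion uses independence of `A`, the other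
  -- its maximality.
  let y : MvPolynomial V K := ∏ a ∈ A, X a
  have hyI : ∀ f, f * y ∈ edgeIdeal K G → f ∈ I := by
    intro f hf
    have hy : y = monomial (∑ a ∈ A, Finsupp.single a 1) 1 := by
      simp [y, X, monomial_sum_one]
    rw [← partialEdgeIdeal_empty, mem_partialEdgeIdeal_iff, hy] at hf
    refine mem_ideal_span_X_image.2 fun m hm => ?_
    have hm' : m + ∑ a ∈ A, Finsupp.single a 1 ∈
        (f * monomial (∑ a ∈ A, Finsupp.single a 1) 1).support := by
      rw [mem_support_iff, coeff_mul_monomial, mul_one]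
      exact mem_support_iff.1 hm
    have hout : ∀ i : V, i ∉ A → (m + ∑ a ∈ A, Finsupp.single a 1 : V →₀ ℕ) i ≠ 0 →
        m i ≠ 0 := by
      intro i hi h
      rwa [Finsupp.add_apply, Finsupp.finsetSum_apply, Finset.sum_eq_zero, add_zero] at h
      intro a ha
      exact Finsupp.single_eq_of_ne fun e => hi (e ▸ ha)
    rcases hf _ hm' with ⟨d, hd, -⟩ | ⟨i, j, hij, hi, hj⟩
    · exact hd.elim
    · by_cases hiA : i ∈ A
      · exact ⟨j, fun hjA => hind i hiA j hjA hij, hout j (fun hjA => hind i hiA j hjA hij) hj⟩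
      · exact ⟨i, hiA, hout i hiA hi⟩
  have hIy : ∀ f ∈ I, f * y ∈ edgeIdeal K G := by
    have : I ≤ Submodule.comap (LinearMap.mulRight (MvPolynomial V K) y) (edgeIdeal K G) := by
      refine Submodule.span_le.2 ?_
      rintro _ ⟨v, hv, rfl⟩
      obtain ⟨a, ha, hva⟩ := hdom v hv
      change X v * y ∈ edgeIdeal K G
      rw [show y = X a * ∏ b ∈ A.erase a, X b from (Finset.mul_prod_erase A _ ha).symm,
        ← mul_assoc]
      exact Ideal.mul_mem_right _ _ (X_mul_X_mem_edgeIdeal hva)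
    exact fun f hf => this hf
  let N := Submodule.span (MvPolynomial V K) {(edgeIdeal K G).mkQ y}
  have hann : Module.annihilator (MvPolynomial V K) N = I := by
    ext f
    change f ∈ N.annihilator ↔ _
    rw [Submodule.mem_annihilator_span_singleton, ← map_smul, Submodule.mkQ_apply,
      Submodule.Quotient.mk_eq_zero, smul_eq_mul]
    exact ⟨hyI f, hIy f⟩
  obtain ⟨p, hp, hIp, hpm⟩ := exists_associatedPrime_le (M := N) (hann.trans_le hIm)
  rw [hann] at hIp
  have hlen := height_map_add_length_le
    (associatedPrimes.subset_of_injective N.injective_subtype hp) hIp hpm hrs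
    hreg.toIsWeaklyRegular
  have hprime : ((idealOfVars V K).map (Ideal.Quotient.mk I)).IsPrime :=
    Ideal.map_isPrime_of_surjective Ideal.Quotient.mk_surjective (by rwa [Ideal.mk_ker])
  have hspan : (idealOfVars V K).map (Ideal.Quotient.mk I) =
      Ideal.span (A.image fun a => Ideal.Quotient.mk I (X a)) := by
    refine le_antisymm ?_ (Ideal.span_le.2 ?_)
    · rw [Ideal.map_span, Ideal.span_le]
      rintro _ ⟨_, ⟨v, rfl⟩, rfl⟩
      by_cases hv : v ∈ A
      · exact Ideal.subset_span (Finset.mem_coe.2 (Finset.mem_image_of_mem _ hv))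
      · have hvI : X v ∈ I := Ideal.subset_span ⟨v, hv, rfl⟩
        rw [Ideal.Quotient.eq_zero_iff_mem.2 hvI]
        exact zero_mem _
    · intro z hz
      obtain ⟨a, -, rfl⟩ := Finset.mem_image.1 (Finset.mem_coe.1 hz)
      exact Ideal.mem_map_of_mem _ (Ideal.subset_span ⟨a, rfl⟩)
  -- Krull's height theorem: modulo `I` only the variables of `A` are needed as generators.
  have hheight : ((idealOfVars V K).map (Ideal.Quotient.mk I)).height ≤
      (A.image fun a => Ideal.Quotient.mk I (X a : MvPolynomial V K)).card := by
    refine Ideal.height_le_card_of_mem_minimalPrimes_span_finset ?_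
    rw [← hspan, Ideal.minimalPrimes_eq_subsingleton_self]
    rfl
  calc (rs.length : ℕ∞) ≤ _ := le_add_self
    _ ≤ _ := hlen
    _ ≤ _ := hheight
    _ ≤ A.card := by exact_mod_cast Finset.card_image_le

end GraphDepth

/-! ### The path graph -/

theorem graphDepth_pathGraph (K : Type*) [Field K] (n : ℕ) :
    graphDepth K (SimpleGraph.pathGraph n) = ((n + 2) / 3 : ℕ) := by
  -- Vertices count from `0`. Start `1` would leave `n - 1` undominated for `n ≡ 1`, and start `0`
  -- would do so for positive `n ≡ 0`.
  obtain ⟨ε, hε⟩ : ∃ ε, n % 3 = 1 ∧ ε = 0 ∨ n % 3 ≠ 1 ∧ ε = 1 := by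
    by_cases h : n % 3 = 1 <;> simp [h]
  let c : Fin ((n + 2) / 3) → Fin n := fun i => ⟨3 * i + ε, by omega⟩
  let A : Finset (Fin n) := Finset.univ.image c
  have hA : ∀ v : Fin n, v ∈ A ↔ v.val % 3 = ε := fun v => by
    simp only [A, c, Finset.mem_image, Finset.mem_univ, true_and]
    constructor
    · rintro ⟨i, rfl⟩
      simp only
      omega
    · intro hv
      have := v.2
      exact ⟨⟨v.val / 3, by omega⟩, Fin.ext (by simp only; omega)⟩
  have hcard : A.card = (n + 2) / 3 := by
    rw [Finset.card_image_of_injective, Finset.card_univ, Fintype.card_fin]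
    intro i j hij
    have := congrArg Fin.val hij
    simp only [c] at this
    exact Fin.ext (by omega)
  rw [← hcard]
  refine le_antisymm (graphDepth_le_card (fun a ha b hb hab => ?_) fun v hv => ?_)
    (card_le_graphDepth fun a ha b hb hab => Finset.disjoint_left.2 fun v hva hvb => hab ?_)
  · rw [hA] at ha hb
    rw [SimpleGraph.pathGraph_adj] at hab
    omega
  · rw [hA] at hv
    have := v.2
    -- The remaining residue uses the successor, which exists by the choice of `ε`.
    by_cases h : v.val % 3 = ε + 1
    · exact ⟨⟨v.val - 1, by omega⟩, (hA _).2 (by simp only; omega),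
        SimpleGraph.pathGraph_adj.2 (.inr (by simp only; omega))⟩
    · exact ⟨⟨v.val + 1, by omega⟩, (hA _).2 (by simp only; omega),
        SimpleGraph.pathGraph_adj.2 (.inl rfl)⟩
  · rw [hA] at ha hb
    rw [mem_closedNeighborFinset, SimpleGraph.pathGraph_adj, Fin.ext_iff] at hva hvb
    exact Fin.ext (by omega)

theorem mainTheorem4 (n : ℕ) (hn : 2 ≤ n) (K : Type*) [Field K] (K' : Type*) [Field K'] :
    graphDepth K (SimpleGraph.pathGraph n) = graphDepth K' (SimpleGraph.pathGraph n) ∧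
    (n ≡ 0 [MOD 3] → graphDepth K (SimpleGraph.pathGraph n) = ((n / 3 : ℕ) : ℕ∞)) ∧
    (n ≡ 1 [MOD 3] → graphDepth K (SimpleGraph.pathGraph n) = (((n + 2) / 3 : ℕ) : ℕ∞)) ∧
    (n ≡ 2 [MOD 3] → graphDepth K (SimpleGraph.pathGraph n) = (((n + 1) / 3 : ℕ) : ℕ∞)) := by
  rw [graphDepth_pathGraph, graphDepth_pathGraph]
  refine ⟨rfl, fun h => ?_, fun _ => rfl, fun h => ?_⟩ <;>
    exact congrArg (Nat.cast : ℕ → ℕ∞) (by rw [Nat.ModEq] at h; omega)
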